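/- Let $N,m\ge 1$ be integers, and let $\mathbb{R}^N_+=\{x\in\mathbb{R}^N : x_1>0\}$. For $u\in W^{2m,1}_{loc}(\Omega)$ the expression $(-\Delta)^m u$ is formed with the weak derivatives of $u$ of order $2m$, and a differential inequality is satisfied in the strong sense if it holds almost everywhere in $\Omega$. (a) Let $g:\mathbb{R}\to[0,\infty)$ be convex with $g(s)>0$ for all $s<0$, and let $v:\mathbb{R}^N\to\mathbb{R}$ be a function in $W^{2m,1}_{loc}(\mathbb{R}^N)\cap C^{2m-1}(\mathbb{R}^N)$ which satisfies $(-\Delta)^m v\ge g(v)$ in $\mathbb{R}^N$ in the strong sense and such that $D^\alpha v$ is bounded on $\mathbb{R}^N$ for every multi-index $\alpha$ with $0\le|\alpha|\le 2m-1$. Then either $v>0$ everywhere in $\mathbb{R}^N$ or $v\equiv 0$. (b) Let $v\in W^{2m,1}_{loc}(\mathbb{R}^N_+)\cap C^{2m-1}(\mathbb{R}^N_+)$ satisfy $(-\Delta)^m v\ge 1$ in $\mathbb{R}^N_+$ in the strong sense. Then the (continuous) function $(-\Delta)^{m-1}v$ is unbounded on $\mathbb{R}^N_+$. -/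

import Mathlib

open Set MeasureTheory
open scoped ContDiff

/-- The half-space `ℝ^N_+ = {x ∈ ℝ^N : x₁ > 0}` (the first coordinate has index `0`). -/
def halfSpace (N : ℕ) [NeZero N] : Set (EuclideanSpace ℝ (Fin N)) :=
  {x | 0 < x 0}

/-- The classical partial derivative `∂_{i₁} ⋯ ∂_{i_k} u` of order `k`. The derivatives `D^α u` with
`|α| = k` are exactly these, the multi-index `α` counting how often each direction occurs in the
sequence `i`. -/
noncomputable def partialDeriv {N k : ℕ} (i : Fin k → Fin N) (u : EuclideanSpace ℝ (Fin N) → ℝ) :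
    EuclideanSpace ℝ (Fin N) → ℝ :=
  fun x => iteratedFDeriv ℝ k u x (fun j => EuclideanSpace.single (i j) (1 : ℝ))

/-- `w ∈ L¹_loc(Ω)` is the weak derivative `∂_{i₁} ⋯ ∂_{i_k} u` on the open set `Ω`. -/
def IsWeakDeriv {N k : ℕ} (Ω : Set (EuclideanSpace ℝ (Fin N))) (i : Fin k → Fin N)
    (u w : EuclideanSpace ℝ (Fin N) → ℝ) : Prop :=
  LocallyIntegrableOn w Ω volume ∧
    ∀ φ : EuclideanSpace ℝ (Fin N) → ℝ, ContDiff ℝ ∞ φ → HasCompactSupport φ → tsupport φ ⊆ Ω →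
      ∫ x in Ω, u x * partialDeriv i φ x = (-1 : ℝ) ^ k * ∫ x in Ω, w x * φ x

/-- `u ∈ W^{n,1}_loc(Ω)`: `u ∈ L¹_loc(Ω)` and all weak derivatives of `u` of order at most `n` exist
in `L¹_loc(Ω)`. -/
def MemSobolevLoc {N : ℕ} (n : ℕ) (Ω : Set (EuclideanSpace ℝ (Fin N)))
    (u : EuclideanSpace ℝ (Fin N) → ℝ) : Prop :=
  LocallyIntegrableOn u Ω volume ∧
    ∀ k ≤ n, ∀ i : Fin k → Fin N, ∃ w, IsWeakDeriv Ω i u w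

open Classical in
/-- The weak derivative `∂_{i₁} ⋯ ∂_{i_k} u` on `Ω` (unique up to null sets), and `0` if there is
none. -/
noncomputable def weakDeriv {N k : ℕ} (Ω : Set (EuclideanSpace ℝ (Fin N))) (i : Fin k → Fin N)
    (u : EuclideanSpace ℝ (Fin N) → ℝ) : EuclideanSpace ℝ (Fin N) → ℝ :=
  if h : ∃ w, IsWeakDeriv Ω i u w then h.choose else 0

/-- The strong polyharmonic operator in terms of weak derivatives of order `2m`,
`(-Δ)^m u = (-1)^m ∑_{i₁, …, i_m} ∂_{i₁}² ⋯ ∂_{i_m}² u`.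
The sequence of directions of length `m * 2` is `i₁, i₁, i₂, i₂, …, i_m, i_m`. -/
noncomputable def weakPolyLaplacian {N : ℕ} (m : ℕ) (Ω : Set (EuclideanSpace ℝ (Fin N)))
    (u : EuclideanSpace ℝ (Fin N) → ℝ) : EuclideanSpace ℝ (Fin N) → ℝ :=
  fun x => (-1 : ℝ) ^ m *
    ∑ i : Fin m → Fin N, weakDeriv Ω (fun l : Fin (m * 2) => i l.divNat) u x

/-- The classical operator `-Δ`. -/
noncomputable def negLaplacian {N : ℕ} (u : EuclideanSpace ℝ (Fin N) → ℝ) :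
    EuclideanSpace ℝ (Fin N) → ℝ :=
  fun x => -(Laplacian.laplacian u x)

/-! For (b), test the inequality with a bump `φ` dilated to scale `R` and placed inside the
half-space. Moving all but `m - 1` Laplacians onto `φ` gives `R ^ N ≤ |C| * K * R ^ (N - 2)` if `C`
bounds `(-Δ)^(m-1) v`, which is false for large `R`.

For (a), mollify `v` to a smooth bounded `w`; Jensen's inequality keeps `g(w) ≤ (-Δ)^m w`. Two facts
about averages over dilations of a radial kernel do the rest: averages of a superharmonic function
lie below its central value (`integral_le_of_negLaplacian_nonneg`), and averages of `-Δu` with `u`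
bounded are `O(R⁻²)` (`nonpos_of_le_abs_integral_negLaplacian`). Together they show that `(-Δ)² u ≥
0` with `u` bounded forces `-Δu ≥ 0`, so descending from `(-Δ)^m w ≥ 0` makes `w` superharmonic. If
`w x < 0`, averages of `w` around `x` stay in a compact interval of negative numbers, where `g` is
bounded below by a positive constant; by Jensen so are the averages of `(-Δ)^m w`, contradicting
their decay. In the limit `v ≥ 0` satisfies the mean value inequality at every scale, and the strong
minimum principle follows. -/

/-- The partial derivative `∂_a f`. -/
noncomputable def dirDeriv {N : ℕ} (a : Fin N) (f : EuclideanSpace ℝ (Fin N) → ℝ) :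
    EuclideanSpace ℝ (Fin N) → ℝ :=
  fun x => fderiv ℝ f x (EuclideanSpace.single a (1 : ℝ))

/-! ### Iterated partial derivatives and powers of the Laplacian -/

section Derivatives

variable {N : ℕ}

theorem ContDiff.dirDeriv {f : EuclideanSpace ℝ (Fin N) → ℝ} (hf : ContDiff ℝ ∞ f) (a : Fin N) :
    ContDiff ℝ ∞ (dirDeriv a f) :=
  (hf.fderiv_right (m := ∞) (by simp)).clm_apply contDiff_const

theorem tsupport_dirDeriv_subset (f : EuclideanSpace ℝ (Fin N) → ℝ) (a : Fin N) :
    tsupport (dirDeriv a f) ⊆ tsupport f :=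
  tsupport_fderiv_apply_subset ℝ _

theorem contDiff_foldr_dirDeriv {f : EuclideanSpace ℝ (Fin N) → ℝ} (hf : ContDiff ℝ ∞ f)
    (l : List (Fin N)) : ContDiff ℝ ∞ (l.foldr dirDeriv f) := by
  induction l with
  | nil => exact hf
  | cons a l ih => exact ih.dirDeriv a

theorem partialDeriv_eq_foldr {f : EuclideanSpace ℝ (Fin N) → ℝ} (hf : ContDiff ℝ ∞ f) {k : ℕ}
    (i : Fin k → Fin N) : partialDeriv i f = (List.ofFn i).foldr dirDeriv f := by
  induction k with
  | zero => ext x; simp [partialDeriv]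
  | succ k ih =>
    rw [List.ofFn_succ, List.foldr_cons, ← ih]
    ext x
    have hd : DifferentiableAt ℝ (iteratedFDeriv ℝ k f) x :=
      (hf.differentiable_iteratedFDeriv (m := k) (by exact_mod_cast ENat.natCast_lt_top k)) x
    rw [partialDeriv, iteratedFDeriv_succ_apply_left]
    exact (fderiv_continuousMultilinear_apply_const_apply hd _ _).symm

theorem negLaplacian_eq_sum_dirDeriv {f : EuclideanSpace ℝ (Fin N) → ℝ}
    {x : EuclideanSpace ℝ (Fin N)} (hf : ContDiffAt ℝ 2 f x) :
    negLaplacian f x = -∑ a, dirDeriv a (dirDeriv a f) x := by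
  have hd : DifferentiableAt ℝ (fderiv ℝ f) x :=
    (hf.fderiv_right (m := 1) (by norm_num)).differentiableAt (by norm_num)
  rw [negLaplacian, InnerProductSpace.laplacian_eq_iteratedFDeriv_orthonormalBasis f
    (EuclideanSpace.basisFun (Fin N) ℝ)]
  congr 1
  refine Finset.sum_congr rfl fun a _ => ?_
  have h := congrArg (fun L => L (EuclideanSpace.single a (1 : ℝ)))
    (fderiv_clm_apply hd (differentiableAt_const (EuclideanSpace.single a (1 : ℝ))))
  rw [iteratedFDeriv_two_apply]
  refine Eq.trans ?_ h.symm
  simp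

theorem negLaplacian_eq_of_contDiff {f : EuclideanSpace ℝ (Fin N) → ℝ} (hf : ContDiff ℝ ∞ f) :
    negLaplacian f = -∑ a, dirDeriv a (dirDeriv a f) := by
  ext x
  rw [negLaplacian_eq_sum_dirDeriv (hf.of_le (by norm_cast)).contDiffAt]
  simp

theorem ContDiff.negLaplacian {f : EuclideanSpace ℝ (Fin N) → ℝ} (hf : ContDiff ℝ ∞ f) :
    ContDiff ℝ ∞ (negLaplacian f) := by
  rw [negLaplacian_eq_of_contDiff hf]
  simp only [Finset.sum_fn]
  exact (ContDiff.sum fun a _ => (hf.dirDeriv a).dirDeriv a).neg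

theorem tsupport_negLaplacian_subset {f : EuclideanSpace ℝ (Fin N) → ℝ} :
    tsupport (negLaplacian f) ⊆ tsupport f := by
  refine closure_minimal (fun x hx => ?_) (isClosed_tsupport f)
  by_contra h
  refine hx ?_
  have h0 : f =ᶠ[nhds x] fun _ => 0 := notMem_tsupport_iff_eventuallyEq.1 h
  rw [_root_.negLaplacian, (InnerProductSpace.laplacian_congr_nhds h0).eq_of_nhds]
  simp

theorem contDiff_iterate_negLaplacian {f : EuclideanSpace ℝ (Fin N) → ℝ} (hf : ContDiff ℝ ∞ f)
    (m : ℕ) : ContDiff ℝ ∞ (negLaplacian^[m] f) := by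
  induction m with
  | zero => exact hf
  | succ m ih => rw [Function.iterate_succ_apply']; exact ih.negLaplacian

theorem tsupport_iterate_negLaplacian_subset {f : EuclideanSpace ℝ (Fin N) → ℝ} (m : ℕ) :
    tsupport (negLaplacian^[m] f) ⊆ tsupport f := by
  induction m with
  | zero => exact subset_rfl
  | succ m ih =>
    rw [Function.iterate_succ_apply']; exact tsupport_negLaplacian_subset.trans ih

theorem HasCompactSupport.iterate_negLaplacian {f : EuclideanSpace ℝ (Fin N) → ℝ}
    (hf : HasCompactSupport f) (m : ℕ) : HasCompactSupport (negLaplacian^[m] f) :=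
  hf.of_isClosed_subset (isClosed_tsupport _) (tsupport_iterate_negLaplacian_subset m)

theorem dirDeriv_const_mul_sum {ι : Type*} [Fintype ι] {F : ι → EuclideanSpace ℝ (Fin N) → ℝ}
    (hF : ∀ j, ContDiff ℝ ∞ (F j)) (c : ℝ) (a : Fin N) :
    dirDeriv a (fun x => c * ∑ j, F j x) = fun x => c * ∑ j, dirDeriv a (F j) x := by
  ext x
  have hd : ∀ j, DifferentiableAt ℝ (F j) x := fun j =>
    ((hF j).differentiable (by simp)) x
  simp only [dirDeriv]
  rw [fderiv_const_mul (DifferentiableAt.fun_sum fun j _ => hd j),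
    fderiv_fun_sum fun j _ => hd j]
  simp

/-- The list `i₁, i₁, i₂, i₂, …` of directions in `(-Δ)^m`. -/
theorem foldr_ofFn_divNat_succ {m : ℕ} (i : Fin (m + 1) → Fin N)
    (f : EuclideanSpace ℝ (Fin N) → ℝ) :
    (List.ofFn fun l : Fin ((m + 1) * 2) => i l.divNat).foldr dirDeriv f =
      dirDeriv (i 0) (dirDeriv (i 0)
        ((List.ofFn fun l : Fin (m * 2) => i l.divNat.succ).foldr dirDeriv f)) := by
  have key : ∀ {k : ℕ} (j : Fin k → Fin N), (List.ofFn fun l : Fin (k * 2) => j l.divNat) =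
      (List.ofFn fun l : Fin k => [j l, j l]).flatten := by
    intro k j
    rw [List.ofFn_mul]
    congr 2
    ext1 l
    have h : ∀ t : Fin 2, (⟨l * 2 + t, by omega⟩ : Fin (k * 2)).divNat = l := by
      intro t; ext; simp only [Fin.coe_divNat]; omega
    simp only [List.ofFn_succ, List.ofFn_zero]
    simpa using ⟨by simpa using congrArg j (h 0), by simpa using congrArg j (h 1)⟩
  rw [key, key (fun t : Fin m => i t.succ), List.ofFn_succ, List.flatten_cons]
  simp

theorem iterate_negLaplacian_eq_sum {f : EuclideanSpace ℝ (Fin N) → ℝ} (hf : ContDiff ℝ ∞ f)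
    (m : ℕ) : negLaplacian^[m] f = fun x => (-1 : ℝ) ^ m *
      ∑ i : Fin m → Fin N, partialDeriv (fun l : Fin (m * 2) => i l.divNat) f x := by
  simp only [partialDeriv_eq_foldr hf]
  induction m with
  | zero => ext x; simp
  | succ m ih =>
    have hc := fun i : Fin m → Fin N =>
      contDiff_foldr_dirDeriv hf (List.ofFn fun l : Fin (m * 2) => i l.divNat)
    rw [Function.iterate_succ_apply',
      negLaplacian_eq_of_contDiff (contDiff_iterate_negLaplacian hf m), ih]
    ext x
    simp only [foldr_ofFn_divNat_succ, Pi.neg_apply, Finset.sum_apply]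
    -- `Fin.consEquiv` splits a sequence of `m + 1` directions into its head `a`, the direction of
    -- the new Laplacian, and its tail.
    rw [← (Fin.consEquiv fun _ : Fin (m + 1) => Fin N).sum_comp, Fintype.sum_prod_type, pow_succ,
      Finset.mul_sum, ← Finset.sum_neg_distrib]
    refine Finset.sum_congr rfl fun a _ => ?_
    rw [dirDeriv_const_mul_sum hc, dirDeriv_const_mul_sum fun i => (hc i).dirDeriv a]
    simp [Fin.consEquiv]

end Derivatives

/-! ### Integration by parts, classical and weak -/

section IntegrationByParts

variable {N : ℕ} {Ω : Set (EuclideanSpace ℝ (Fin N))}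

theorem integrable_mul_of_tsupport_subset (hΩ : IsOpen Ω)
    {f φ : EuclideanSpace ℝ (Fin N) → ℝ} (hf : ContinuousOn f Ω) (hφ : Continuous φ)
    (hc : HasCompactSupport φ) (hs : tsupport φ ⊆ Ω) : Integrable fun x => f x * φ x :=
  ((hf.mul hφ.continuousOn).continuous_of_tsupport_subset hΩ
    ((tsupport_mul_subset_right (f := f) (g := φ)).trans hs)).integrable_of_hasCompactSupport
    (hc.mul_left (f := f))

theorem ContDiffOn.dirDeriv {n k : ℕ} (hΩ : IsOpen Ω) {f : EuclideanSpace ℝ (Fin N) → ℝ}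
    (hf : ContDiffOn ℝ k f Ω) (hn : n + 1 ≤ k) (a : Fin N) :
    ContDiffOn ℝ n (dirDeriv a f) Ω :=
  (hf.fderiv_of_isOpen hΩ (by exact_mod_cast hn)).clm_apply contDiffOn_const

theorem ContDiffOn.negLaplacian {n k : ℕ} (hΩ : IsOpen Ω) {f : EuclideanSpace ℝ (Fin N) → ℝ}
    (hf : ContDiffOn ℝ k f Ω) (hn : n + 2 ≤ k) : ContDiffOn ℝ n (negLaplacian f) Ω := by
  refine ContDiffOn.congr (f := fun x => -∑ a, _root_.dirDeriv a (_root_.dirDeriv a f) x) ?_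
    fun x hx => negLaplacian_eq_sum_dirDeriv
      ((hf.contDiffAt (hΩ.mem_nhds hx)).of_le (by exact_mod_cast (by omega : 2 ≤ k)))
  exact (ContDiffOn.sum fun a _ => (hf.dirDeriv (n := n + 1) hΩ hn a).dirDeriv hΩ le_rfl a).neg

theorem ContDiffOn.iterate_negLaplacian {n k : ℕ} (hΩ : IsOpen Ω)
    {f : EuclideanSpace ℝ (Fin N) → ℝ} (j : ℕ) (hf : ContDiffOn ℝ k f Ω) (hn : n + 2 * j ≤ k) :
    ContDiffOn ℝ n (_root_.negLaplacian^[j] f) Ω := by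
  induction j generalizing n with
  | zero => exact hf.of_le (by exact_mod_cast (by omega : n ≤ k))
  | succ j ih =>
    rw [Function.iterate_succ_apply']
    exact (ih (n := n + 2) (by omega)).negLaplacian hΩ le_rfl

/-- The integrals run over the whole space although `f` is regular only on `Ω`: values off `Ω` are
multiplied by zero, and differentiability of `f` is needed only on `tsupport φ`. -/
theorem integral_dirDeriv_mul (hΩ : IsOpen Ω) {f φ : EuclideanSpace ℝ (Fin N) → ℝ}
    (hf : ContDiffOn ℝ 1 f Ω) (hφ : ContDiff ℝ ∞ φ) (hc : HasCompactSupport φ)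
    (hs : tsupport φ ⊆ Ω) (a : Fin N) :
    ∫ x, dirDeriv a f x * φ x = -∫ x, f x * dirDeriv a φ x := by
  have hc' : HasCompactSupport (dirDeriv a φ) :=
    hc.of_isClosed_subset (isClosed_tsupport _) (tsupport_dirDeriv_subset φ a)
  have h1 := integrable_mul_of_tsupport_subset hΩ
    (ContDiffOn.dirDeriv (n := 0) (k := 1) hΩ hf le_rfl a).continuousOn hφ.continuous hc hs
  have h2 := integrable_mul_of_tsupport_subset hΩ hf.continuousOn
    (hφ.dirDeriv a).continuous hc' ((tsupport_dirDeriv_subset φ a).trans hs)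
  have h3 := integrable_mul_of_tsupport_subset hΩ hf.continuousOn hφ.continuous hc hs
  simp only [mul_comm _ (φ _)] at h1 h3 ⊢
  simp only [mul_comm (f _)] at h2 ⊢
  refine integral_mul_fderiv_eq_neg_fderiv_mul_of_integrable h2 h1 h3
    (fun x _ => hφ.differentiable (by simp) x) fun x hx => ?_
  exact (hf.contDiffAt (hΩ.mem_nhds (hs hx))).differentiableAt (by simp)

theorem integral_negLaplacian_mul (hΩ : IsOpen Ω) {f φ : EuclideanSpace ℝ (Fin N) → ℝ}
    (hf : ContDiffOn ℝ 2 f Ω) (hφ : ContDiff ℝ ∞ φ) (hc : HasCompactSupport φ)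
    (hs : tsupport φ ⊆ Ω) :
    ∫ x, negLaplacian f x * φ x = ∫ x, f x * negLaplacian φ x := by
  have hf1 : ContDiffOn ℝ 1 f Ω := hf.of_le (by norm_num)
  have hd : ∀ a, ContDiffOn ℝ 1 (dirDeriv a f) Ω :=
    ContDiffOn.dirDeriv (n := 1) (k := 2) hΩ hf le_rfl
  have hcs : ∀ a, HasCompactSupport (dirDeriv a φ) := fun a =>
    hc.of_isClosed_subset (isClosed_tsupport _) (tsupport_dirDeriv_subset φ a)
  have hss : ∀ a, tsupport (dirDeriv a φ) ⊆ Ω := fun a => (tsupport_dirDeriv_subset φ a).trans hs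
  have e1 : ∀ x, negLaplacian f x * φ x = -∑ a, dirDeriv a (dirDeriv a f) x * φ x := by
    intro x
    by_cases hx : x ∈ Ω
    · rw [negLaplacian_eq_sum_dirDeriv (hf.contDiffAt (hΩ.mem_nhds hx)), neg_mul, Finset.sum_mul]
    · simp [image_eq_zero_of_notMem_tsupport fun h => hx (hs h)]
  have e2 : ∀ x, f x * negLaplacian φ x = -∑ a, f x * dirDeriv a (dirDeriv a φ) x := by
    intro x
    simp [negLaplacian_eq_of_contDiff hφ, Finset.mul_sum]
  simp only [e1, e2, integral_neg]
  rw [integral_finsetSum, integral_finsetSum]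
  · congr 1
    refine Finset.sum_congr rfl fun a _ => ?_
    rw [integral_dirDeriv_mul hΩ (hd a) hφ hc hs, integral_dirDeriv_mul hΩ hf1 (hφ.dirDeriv a)
      (hcs a) (hss a), neg_neg]
  · exact fun a _ => integrable_mul_of_tsupport_subset hΩ hf.continuousOn
      ((hφ.dirDeriv a).dirDeriv a).continuous
      ((hcs a).of_isClosed_subset (isClosed_tsupport _) (tsupport_dirDeriv_subset _ a))
      ((tsupport_dirDeriv_subset _ a).trans (hss a))
  · exact fun a _ => integrable_mul_of_tsupport_subset hΩ
      (ContDiffOn.dirDeriv (n := 0) (k := 1) hΩ (hd a) le_rfl a).continuousOn hφ.continuous hc hs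

theorem integral_iterate_negLaplacian_mul (hΩ : IsOpen Ω) {f φ : EuclideanSpace ℝ (Fin N) → ℝ}
    (j : ℕ) (hf : ContDiffOn ℝ (2 * j : ℕ) f Ω) (hφ : ContDiff ℝ ∞ φ) (hc : HasCompactSupport φ)
    (hs : tsupport φ ⊆ Ω) :
    ∫ x, negLaplacian^[j] f x * φ x = ∫ x, f x * negLaplacian^[j] φ x := by
  induction j generalizing f with
  | zero => rfl
  | succ j ih =>
    rw [Function.iterate_succ_apply, ih (hf.negLaplacian hΩ (by omega)),
      Function.iterate_succ_apply']
    exact integral_negLaplacian_mul hΩ (hf.of_le (by exact_mod_cast (by omega)))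
      (contDiff_iterate_negLaplacian hφ j) (hc.iterate_negLaplacian j)
      ((tsupport_iterate_negLaplacian_subset j).trans hs)

theorem MeasureTheory.LocallyIntegrableOn.integrable_mul_of_tsupport_subset
    {w φ : EuclideanSpace ℝ (Fin N) → ℝ} (hw : LocallyIntegrableOn w Ω) (hφ : Continuous φ)
    (hc : HasCompactSupport φ) (hs : tsupport φ ⊆ Ω) : Integrable fun x => w x * φ x := by
  have h := (hw.integrableOn_compact_subset hs hc).mul_continuousOn hφ.continuousOn hc
  refine (integrableOn_iff_integrable_of_support_subset fun x hx => ?_).1 h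
  exact subset_tsupport φ (right_ne_zero_of_mul hx)

theorem MemSobolevLoc.isWeakDeriv_weakDeriv {n k : ℕ} {u : EuclideanSpace ℝ (Fin N) → ℝ}
    (hu : MemSobolevLoc n Ω u) (hk : k ≤ n) (i : Fin k → Fin N) :
    IsWeakDeriv Ω i u (weakDeriv Ω i u) := by
  have h := hu.2 k hk i
  rw [weakDeriv, dif_pos h]
  exact h.choose_spec

theorem MemSobolevLoc.locallyIntegrableOn_weakPolyLaplacian {m : ℕ}
    {u : EuclideanSpace ℝ (Fin N) → ℝ} (hu : MemSobolevLoc (2 * m) Ω u) :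
    LocallyIntegrableOn (weakPolyLaplacian m Ω u) Ω := by
  have h : ∀ i : Fin m → Fin N, LocallyIntegrableOn
      (weakDeriv Ω (fun l : Fin (m * 2) => i l.divNat) u) Ω := fun i =>
    (hu.isWeakDeriv_weakDeriv (by omega) _).1
  intro x hx
  choose s hs hi using fun i => h i x hx
  refine ⟨⋂ i, s i, (Filter.iInter_mem).2 hs, ?_⟩
  exact (integrable_finsetSum _ fun i _ => (hi i).mono_set (iInter_subset s i)).const_mul _

theorem MemSobolevLoc.integral_weakPolyLaplacian_mul {m : ℕ}
    {u φ : EuclideanSpace ℝ (Fin N) → ℝ} (hu : MemSobolevLoc (2 * m) Ω u) (hφ : ContDiff ℝ ∞ φ)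
    (hc : HasCompactSupport φ) (hs : tsupport φ ⊆ Ω) :
    ∫ x, weakPolyLaplacian m Ω u x * φ x = ∫ x, u x * negLaplacian^[m] φ x := by
  have hw := fun i : Fin m → Fin N =>
    hu.isWeakDeriv_weakDeriv (by omega) (fun l : Fin (m * 2) => i l.divNat)
  have hsub : ∀ i : Fin m → Fin N,
      tsupport (partialDeriv (fun l : Fin (m * 2) => i l.divNat) φ) ⊆ tsupport φ := by
    intro i
    rw [partialDeriv_eq_foldr hφ]
    induction List.ofFn fun l : Fin (m * 2) => i l.divNat with
    | nil => exact subset_rfl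
    | cons a l ih => exact (tsupport_dirDeriv_subset _ a).trans ih
  have hcont : ∀ i : Fin m → Fin N,
      Continuous (partialDeriv (fun l : Fin (m * 2) => i l.divNat) φ) := by
    intro i
    rw [partialDeriv_eq_foldr hφ]
    exact (contDiff_foldr_dirDeriv hφ _).continuous
  have hzero : ∀ {ψ w : EuclideanSpace ℝ (Fin N) → ℝ}, tsupport ψ ⊆ Ω →
      ∫ x in Ω, w x * ψ x = ∫ x, w x * ψ x := fun {ψ w} h =>
    setIntegral_eq_integral_of_forall_compl_eq_zero fun x hx => by
      simp [image_eq_zero_of_notMem_tsupport fun h' => hx (h h')]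
  have key : ∀ i : Fin m → Fin N,
      ∫ x, weakDeriv Ω (fun l : Fin (m * 2) => i l.divNat) u x * φ x =
        ∫ x, u x * partialDeriv (fun l : Fin (m * 2) => i l.divNat) φ x := by
    intro i
    have h := (hw i).2 φ hφ hc hs
    -- The order `m * 2` is even, so the sign in the weak derivative is `1`.
    rw [hzero ((hsub i).trans hs), hzero hs, pow_mul'] at h
    simpa using h.symm
  rw [iterate_negLaplacian_eq_sum hφ]
  simp only [weakPolyLaplacian, mul_assoc, mul_left_comm (u _), Finset.sum_mul, Finset.mul_sum]
  rw [integral_finsetSum, integral_finsetSum]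
  · exact Finset.sum_congr rfl fun i _ => by rw [integral_const_mul, integral_const_mul, key i]
  · exact fun i _ => Integrable.const_mul (hu.1.integrable_mul_of_tsupport_subset (hcont i)
      (hc.of_isClosed_subset (isClosed_tsupport _) (hsub i)) ((hsub i).trans hs)) _
  · exact fun i _ =>
      ((hw i).1.integrable_mul_of_tsupport_subset hφ.continuous hc hs).const_mul _

end IntegrationByParts

/-! ### Behaviour under translation, dilation and reflection -/

section Dilations

variable {N : ℕ}

theorem dirDeriv_comp_add_smul (f : EuclideanSpace ℝ (Fin N) → ℝ) (a : Fin N)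
    (x₀ : EuclideanSpace ℝ (Fin N)) (c : ℝ) :
    dirDeriv a (fun x => f (x₀ + c • x)) = fun x => c * dirDeriv a f (x₀ + c • x) := by
  ext x
  have h1 := fderiv_comp_smul (𝕜 := ℝ) (f := fun y => f (x₀ + y)) (x := x) c
  simp only [dirDeriv, h1, fderiv_comp_add_left]
  simp

theorem dirDeriv_const_mul (f : EuclideanSpace ℝ (Fin N) → ℝ) (a : Fin N) (c : ℝ) :
    dirDeriv a (fun x => c * f x) = fun x => c * dirDeriv a f x := by
  ext x
  exact congrArg (fun L => L x (EuclideanSpace.single a (1 : ℝ)))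
    (fderiv_const_smul_field (𝕜 := ℝ) (f := f) c)

theorem negLaplacian_comp_add_smul {f : EuclideanSpace ℝ (Fin N) → ℝ} (hf : ContDiff ℝ ∞ f)
    (x₀ : EuclideanSpace ℝ (Fin N)) (c : ℝ) :
    negLaplacian (fun x => f (x₀ + c • x)) = fun x => c ^ 2 * negLaplacian f (x₀ + c • x) := by
  have hc : ContDiff ℝ ∞ fun x => f (x₀ + c • x) := hf.comp (by fun_prop)
  rw [negLaplacian_eq_of_contDiff hf, negLaplacian_eq_of_contDiff hc]
  ext x
  simp only [dirDeriv_comp_add_smul, dirDeriv_const_mul, Pi.neg_apply, Finset.sum_apply,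
    mul_neg, Finset.mul_sum, sq, mul_assoc]

theorem iterate_negLaplacian_comp_sub {f : EuclideanSpace ℝ (Fin N) → ℝ} (hf : ContDiff ℝ ∞ f)
    (x₀ : EuclideanSpace ℝ (Fin N)) (m : ℕ) :
    negLaplacian^[m] (fun x => f (x₀ - x)) = fun x => negLaplacian^[m] f (x₀ - x) := by
  induction m with
  | zero => rfl
  | succ m ih =>
    rw [Function.iterate_succ_apply', ih, Function.iterate_succ_apply']
    simpa [← sub_eq_add_neg] using
      negLaplacian_comp_add_smul (contDiff_iterate_negLaplacian hf m) x₀ (-1)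

theorem HasCompactSupport.comp_add_smul {f : EuclideanSpace ℝ (Fin N) → ℝ}
    (hf : HasCompactSupport f) (x₀ : EuclideanSpace ℝ (Fin N)) {c : ℝ} (hc : c ≠ 0) :
    HasCompactSupport fun x => f (x₀ + c • x) :=
  hf.comp_homeomorph ((Homeomorph.smulOfNeZero c hc).trans (Homeomorph.addLeft x₀))

theorem HasCompactSupport.comp_sub_left {f : EuclideanSpace ℝ (Fin N) → ℝ}
    (hf : HasCompactSupport f) (x₀ : EuclideanSpace ℝ (Fin N)) :
    HasCompactSupport fun x => f (x₀ - x) :=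
  hf.comp_homeomorph (Homeomorph.subLeft x₀)

theorem integral_comp_add_smul (f : EuclideanSpace ℝ (Fin N) → ℝ)
    (x₀ : EuclideanSpace ℝ (Fin N)) (c : ℝ) :
    ∫ x, f (x₀ + c • x) = |(c ^ N)⁻¹| * ∫ x, f x := by
  have h := Measure.integral_comp_smul volume (fun y => f (x₀ + y)) c
  rw [h, integral_add_left_eq_self]
  simp

end Dilations

/-! ### Part (b): the half-space -/

section HalfSpace

variable {N : ℕ} [NeZero N]

theorem isOpen_halfSpace : IsOpen (halfSpace N) :=
  isOpen_lt continuous_const (by fun_prop)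

theorem MemSobolevLoc.not_exists_bound_halfSpace {m : ℕ} (hm : 1 ≤ m)
    {v : EuclideanSpace ℝ (Fin N) → ℝ} (hv : MemSobolevLoc (2 * m) (halfSpace N) v)
    (hd : ContDiffOn ℝ ((2 * m - 1 : ℕ) : ℕ∞) v (halfSpace N))
    (h1 : ∀ᵐ x ∂(volume.restrict (halfSpace N)), 1 ≤ weakPolyLaplacian m (halfSpace N) v x) :
    ¬ ∃ C : ℝ, ∀ x ∈ halfSpace N, |negLaplacian^[m - 1] v x| ≤ C := by
  rintro ⟨C, hC⟩
  obtain ⟨n, rfl⟩ : ∃ n, m = n + 1 := ⟨m - 1, by omega⟩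
  rw [Nat.add_sub_cancel] at hC
  let b : ContDiffBump (0 : EuclideanSpace ℝ (Fin N)) := ⟨1, 2, one_pos, one_lt_two⟩
  set ψ : EuclideanSpace ℝ (Fin N) → ℝ := b.normed volume with hψ_def
  have hψ : ContDiff ℝ ∞ ψ := b.contDiff_normed
  have hψc : HasCompactSupport ψ := b.hasCompactSupport_normed
  set K := ∫ x, |negLaplacian ψ x| with hK
  -- The test will yield `R ^ 2 ≤ |C| * K`, while `R ≥ 1` gives `R ^ 2 ≥ R > |C| * K`.
  set R : ℝ := |C| * K + 1 with hR
  have hK0 : 0 ≤ K := integral_nonneg fun x => abs_nonneg _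
  have hR1 : 1 ≤ R := by rw [hR]; nlinarith [abs_nonneg C]
  have hR0 : 0 < R := by linarith
  -- `ψ` is supported in the ball of radius `2`, so a shift by `3` forces `x 0 ≥ R` on the support
  -- of `φ`.
  set x₀ : EuclideanSpace ℝ (Fin N) := -EuclideanSpace.single 0 (3 : ℝ) with hx₀
  set φ : EuclideanSpace ℝ (Fin N) → ℝ := fun x => ψ (x₀ + R⁻¹ • x) with hφ_def
  have hφ : ContDiff ℝ ∞ φ := hψ.comp (by fun_prop)
  have hφc : HasCompactSupport φ := hψc.comp_add_smul x₀ (inv_ne_zero hR0.ne')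
  have hφs : tsupport φ ⊆ halfSpace N := by
    intro x hx
    have h : x₀ + R⁻¹ • x ∈ tsupport ψ :=
      tsupport_comp_subset_preimage (f := fun y => x₀ + R⁻¹ • y) ψ (by fun_prop) hx
    rw [hψ_def, b.tsupport_normed_eq, mem_closedBall_zero_iff] at h
    have h2 := (abs_le.1 ((PiLp.norm_apply_le (x₀ + R⁻¹ • x) 0).trans h)).1
    have h3 : -(2 : ℝ) ≤ -3 + R⁻¹ * x 0 := by simpa [hx₀, b] using h2
    exact pos_of_mul_pos_right (by linarith : 0 < R⁻¹ * x 0) (inv_nonneg.2 hR0.le)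
  have hzero : ∀ {ζ : EuclideanSpace ℝ (Fin N) → ℝ}, tsupport ζ ⊆ tsupport φ →
      ∀ x ∉ halfSpace N, ζ x = 0 := fun {ζ} h x hx =>
    image_eq_zero_of_notMem_tsupport fun h' => hx (hφs (h h'))
  have hlow : ∫ x, φ x ≤ ∫ x, weakPolyLaplacian (n + 1) (halfSpace N) v x * φ x := by
    refine integral_mono_ae (hφ.continuous.integrable_of_hasCompactSupport hφc)
      (hv.locallyIntegrableOn_weakPolyLaplacian.integrable_mul_of_tsupport_subset hφ.continuous
        hφc hφs) ?_
    filter_upwards [(ae_restrict_iff' isOpen_halfSpace.measurableSet).1 h1] with x hx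
    by_cases hxm : x ∈ halfSpace N
    · exact le_mul_of_one_le_left (b.nonneg_normed _) (hx hxm)
    · simp [hzero subset_rfl x hxm]
  have hd' : ContDiffOn ℝ (2 * (n + 1) - 1 : ℕ) v (halfSpace N) := by exact_mod_cast hd
  have hφ' := hφ.negLaplacian
  have hφc' : HasCompactSupport (negLaplacian φ) := hφc.iterate_negLaplacian 1
  have hid : ∫ x, weakPolyLaplacian (n + 1) (halfSpace N) v x * φ x =
      ∫ x, negLaplacian^[n] v x * negLaplacian φ x := by
    rw [hv.integral_weakPolyLaplacian_mul hφ hφc hφs, Function.iterate_succ_apply,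
      integral_iterate_negLaplacian_mul isOpen_halfSpace n
        (hd'.of_le (by exact_mod_cast (by omega : 2 * n ≤ 2 * (n + 1) - 1))) hφ' hφc'
        (tsupport_negLaplacian_subset.trans hφs)]
  have hup : ∫ x, negLaplacian^[n] v x * negLaplacian φ x ≤ ∫ x, |C| * |negLaplacian φ x| := by
    refine integral_mono (integrable_mul_of_tsupport_subset isOpen_halfSpace
      (hd'.iterate_negLaplacian (n := 0) isOpen_halfSpace n (by omega)).continuousOn
      hφ'.continuous hφc' (tsupport_negLaplacian_subset.trans hφs))
      ((hφ'.continuous.integrable_of_hasCompactSupport hφc').abs.const_mul _) fun x => ?_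
    by_cases hxm : x ∈ halfSpace N
    · refine (le_abs_self _).trans ?_
      rw [abs_mul]
      exact mul_le_mul_of_nonneg_right ((hC x hxm).trans (le_abs_self C)) (abs_nonneg _)
    · simp [hzero tsupport_negLaplacian_subset x hxm]
  have e1 : ∫ x, φ x = R ^ N := by
    rw [hφ_def, integral_comp_add_smul, hψ_def, b.integral_normed, mul_one, inv_pow, inv_inv,
      abs_of_pos (by positivity)]
  have e2 : ∫ x, |C| * |negLaplacian φ x| = |C| * ((R⁻¹) ^ 2 * (R ^ N * K)) := by
    rw [integral_const_mul, hφ_def, negLaplacian_comp_add_smul hψ]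
    have := integral_comp_add_smul (fun x => |negLaplacian ψ x|) x₀ R⁻¹
    rw [inv_pow, inv_inv, abs_of_pos (by positivity)] at this
    simp only [abs_mul, integral_const_mul, this, abs_of_pos (by positivity : 0 < R⁻¹ ^ 2), hK]
  rw [hid] at hlow
  have h := hlow.trans hup
  rw [e1, e2] at h
  have hp : 0 < R ^ N := by positivity
  have h4 : 1 ≤ |C| * K * (R⁻¹) ^ 2 := by
    by_contra! h5
    nlinarith
  rw [inv_pow, ← div_eq_mul_inv, le_div_iff₀ (by positivity)] at h4
  nlinarith

end HalfSpace

/-! ### A radial averaging kernel with a potential -/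

section RadialKernel

variable {N : ℕ}

/-- A smooth compactly supported probability density `ρ` that is positive on the unit ball and
satisfies `y ρ(y) = -∇Ψ(y)` for a nonnegative potential `Ψ`. -/
structure IsRadialKernel (ρ Ψ : EuclideanSpace ℝ (Fin N) → ℝ) : Prop where
  contDiff : ContDiff ℝ ∞ ρ
  hasCompactSupport : HasCompactSupport ρ
  nonneg : ∀ y, 0 ≤ ρ y
  pos : ∀ y, ‖y‖ < 1 → 0 < ρ y
  integral_eq_one : ∫ y, ρ y = 1
  contDiff_potential : ContDiff ℝ ∞ Ψ
  hasCompactSupport_potential : HasCompactSupport Ψ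
  potential_nonneg : ∀ y, 0 ≤ Ψ y
  dirDeriv_potential : ∀ a y, dirDeriv a Ψ y = -(y a * ρ y)

theorem hasCompactSupport_comp_normSq {h : ℝ → ℝ} (hh : ∀ s, 1 ≤ s → h s = 0) :
    HasCompactSupport fun y : EuclideanSpace ℝ (Fin N) => h (‖y‖ ^ 2) := by
  refine HasCompactSupport.intro (isCompact_closedBall 0 1) fun y hy => hh _ ?_
  rw [mem_closedBall_zero_iff, not_le] at hy
  nlinarith

variable (N) in
-- Take `ρ` proportional to `θ(‖y‖²)` and `Ψ` to `H(‖y‖²)`, where `H' = -θ` and `H` vanishes from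
-- `1` on. The gradient of `H(‖y‖²)` is `-2 θ(‖y‖²) y`, whence the factor `2⁻¹`.
theorem exists_isRadialKernel :
    ∃ ρ Ψ : EuclideanSpace ℝ (Fin N) → ℝ, IsRadialKernel ρ Ψ := by
  set θ : ℝ → ℝ := fun s => expNegInvGlue (1 - s) with hθ_def
  have hθ : ContDiff ℝ ∞ θ := expNegInvGlue.contDiff.comp (by fun_prop)
  have hθ0 : ∀ s, 0 ≤ θ s := fun s => expNegInvGlue.nonneg _
  have hθz : ∀ s, 1 ≤ s → θ s = 0 := fun s hs => expNegInvGlue.zero_of_nonpos (by linarith)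
  set H : ℝ → ℝ := fun s => -∫ t in (1 : ℝ)..s, θ t with hH_def
  have hH' : ∀ s, HasDerivAt H (-θ s) s := fun s =>
    (intervalIntegral.integral_hasDerivAt_right (hθ.continuous.intervalIntegrable _ _)
      (hθ.continuous.stronglyMeasurableAtFilter _ _) hθ.continuous.continuousAt).neg
  have hH : ContDiff ℝ ∞ H := by
    refine contDiff_infty_iff_deriv.2 ⟨fun s => (hH' s).differentiableAt, ?_⟩
    rw [show deriv H = fun s => -θ s from funext fun s => (hH' s).deriv]
    exact hθ.neg
  have hHz : ∀ s, 1 ≤ s → H s = 0 := by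
    intro s hs
    rw [hH_def]
    simp only [neg_eq_zero]
    refine intervalIntegral.integral_zero_ae (.of_forall fun t ht => hθz t ?_)
    rw [uIoc_of_le hs] at ht
    exact ht.1.le
  have hH0 : ∀ s, 0 ≤ H s := by
    intro s
    rcases le_total 1 s with hs | hs
    · exact (hHz s hs).ge
    · have h : Antitone H := antitone_of_deriv_nonpos (fun s => (hH' s).differentiableAt)
        fun s => by rw [(hH' s).deriv]; exact neg_nonpos.2 (hθ0 s)
      exact (hHz 1 le_rfl).ge.trans (h hs)
  have hn : ContDiff ℝ ∞ fun y : EuclideanSpace ℝ (Fin N) => ‖y‖ ^ 2 := contDiff_norm_sq ℝ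
  set ρ₀ : EuclideanSpace ℝ (Fin N) → ℝ := fun y => θ (‖y‖ ^ 2) with hρ₀
  have hρc : HasCompactSupport ρ₀ := hasCompactSupport_comp_normSq hθz
  have hρs : ContDiff ℝ ∞ ρ₀ := hθ.comp hn
  have hpos : ∀ y, ‖y‖ < 1 → 0 < ρ₀ y := fun y hy =>
    expNegInvGlue.pos_of_pos (by nlinarith [norm_nonneg y])
  set I := ∫ y, ρ₀ y with hI
  have hI0 : 0 < I := by
    refine (integral_pos_iff_support_of_nonneg (fun y => hθ0 _)
      (hρs.continuous.integrable_of_hasCompactSupport hρc)).2 ?_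
    exact hρs.continuous.isOpen_support.measure_pos _ ⟨0, (hpos 0 (by simp)).ne'⟩
  refine ⟨fun y => I⁻¹ * ρ₀ y, fun y => (I⁻¹ * 2⁻¹) * H (‖y‖ ^ 2), ?_, ?_, ?_, ?_, ?_, ?_, ?_, ?_,
    ?_⟩
  · exact contDiff_const.mul hρs
  · exact hρc.mul_left (f := fun _ => I⁻¹)
  · exact fun y => mul_nonneg (inv_nonneg.2 hI0.le) (hθ0 _)
  · exact fun y hy => mul_pos (inv_pos.2 hI0) (hpos y hy)
  · rw [integral_const_mul, inv_mul_cancel₀ hI0.ne']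
  · exact contDiff_const.mul (hH.comp hn)
  · exact (hasCompactSupport_comp_normSq hHz).mul_left (f := fun _ => I⁻¹ * 2⁻¹)
  · exact fun y => mul_nonneg (by positivity) (hH0 _)
  · intro a y
    have h := (hH' (‖y‖ ^ 2)).comp_hasFDerivAt y (hasStrictFDerivAt_norm_sq y).hasFDerivAt
    have h2 := congrArg (fun L => L (EuclideanSpace.single a (1 : ℝ))) h.fderiv
    simp only [Function.comp_def] at h2
    rw [dirDeriv_const_mul]
    simp only [dirDeriv]
    rw [h2]
    simp [EuclideanSpace.inner_single_right]
    ring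

end RadialKernel

/-! ### Averages over dilated kernels -/

section Dilation

variable {N : ℕ}

theorem fderiv_apply_eq_sum_dirDeriv (f : EuclideanSpace ℝ (Fin N) → ℝ)
    (x y : EuclideanSpace ℝ (Fin N)) : fderiv ℝ f x y = ∑ a, y a * dirDeriv a f x := by
  have h : y = ∑ a, y a • EuclideanSpace.single a (1 : ℝ) := by
    simpa using ((EuclideanSpace.basisFun (Fin N) ℝ).sum_repr y).symm
  conv_lhs => rw [h]
  simp [dirDeriv]

theorem hasDerivAt_integral_dilation {w ρ : EuclideanSpace ℝ (Fin N) → ℝ} (hw : ContDiff ℝ ∞ w)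
    (hρ : Continuous ρ) (hc : HasCompactSupport ρ) (x₀ : EuclideanSpace ℝ (Fin N)) (R : ℝ) :
    HasDerivAt (fun R : ℝ => ∫ y, w (x₀ + R • y) * ρ y)
      (∫ y, fderiv ℝ w (x₀ + R • y) y * ρ y) R := by
  have hw' : Continuous (fderiv ℝ w) := hw.continuous_fderiv (by simp)
  have hcont : Continuous fun p : ℝ × EuclideanSpace ℝ (Fin N) =>
      fderiv ℝ w (x₀ + p.1 • p.2) p.2 * ρ p.2 := by fun_prop
  obtain ⟨B, hB⟩ := ((isCompact_closedBall R 1).prod hc).exists_bound_of_continuousOn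
    hcont.continuousOn
  have hwc := hw.continuous
  refine (hasDerivAt_integral_of_dominated_loc_of_deriv_le (μ := volume) (s := Metric.ball R 1)
    (F' := fun r y => fderiv ℝ w (x₀ + r • y) y * ρ y)
    (bound := (tsupport ρ).indicator fun _ => B) (Metric.ball_mem_nhds R one_pos)
    (.of_forall fun r => (by fun_prop : Continuous fun y =>
      w (x₀ + r • y) * ρ y).aestronglyMeasurable) ?_ ?_ ?_ ?_ ?_).2
  · exact (by fun_prop : Continuous fun y => w (x₀ + R • y) * ρ y).integrable_of_hasCompactSupport
      (hc.mul_left (f := fun y => w (x₀ + R • y)))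
  · exact (hcont.comp (by fun_prop : Continuous fun y : EuclideanSpace ℝ (Fin N) =>
      (R, y))).aestronglyMeasurable
  · refine .of_forall fun y r hr => ?_
    by_cases hy : y ∈ tsupport ρ
    · rw [indicator_of_mem hy]
      exact hB (r, y) ⟨Metric.ball_subset_closedBall hr, hy⟩
    · simp [indicator_of_notMem hy, image_eq_zero_of_notMem_tsupport hy]
  · exact (integrable_indicator_iff (isClosed_tsupport ρ).measurableSet).2
      (integrableOn_const hc.measure_lt_top.ne)
  · refine .of_forall fun y r _ => HasDerivAt.mul_const ?_ _
    have h1 : HasDerivAt (fun r : ℝ => x₀ + r • y) y r := by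
      simpa using ((hasDerivAt_id r).smul_const y).const_add x₀
    exact ((hw.differentiable (by simp)) (x₀ + r • y)).hasFDerivAt.comp_hasDerivAt r h1

variable {ρ Ψ : EuclideanSpace ℝ (Fin N) → ℝ}

/-- Since `y ρ = -∇Ψ`, the left side is `-∫ ∇w(x₀ + R y) · ∇Ψ`; integration by parts moves the
gradient off `Ψ`, and the chain rule produces `R`. This signs the derivative in `R` of the averages
of `w`. -/
theorem IsRadialKernel.integral_fderiv_mul (hρ : IsRadialKernel ρ Ψ)
    {w : EuclideanSpace ℝ (Fin N) → ℝ} (hw : ContDiff ℝ ∞ w) (x₀ : EuclideanSpace ℝ (Fin N))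
    (R : ℝ) :
    ∫ y, fderiv ℝ w (x₀ + R • y) y * ρ y = -(R * ∫ y, negLaplacian w (x₀ + R • y) * Ψ y) := by
  have hd : ∀ a, ContDiff ℝ ∞ fun y => dirDeriv a w (x₀ + R • y) := fun a =>
    (hw.dirDeriv a).comp (by fun_prop)
  have hdd : ∀ a, ContDiff ℝ ∞ fun y => dirDeriv a (dirDeriv a w) (x₀ + R • y) := fun a =>
    ((hw.dirDeriv a).dirDeriv a).comp (by fun_prop)
  have e1 : ∀ y, fderiv ℝ w (x₀ + R • y) y * ρ y =
      ∑ a, -(dirDeriv a w (x₀ + R • y) * dirDeriv a Ψ y) := by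
    intro y
    rw [fderiv_apply_eq_sum_dirDeriv, Finset.sum_mul]
    refine Finset.sum_congr rfl fun a _ => ?_
    rw [hρ.dirDeriv_potential]
    ring
  have e2 : ∀ y, negLaplacian w (x₀ + R • y) * Ψ y =
      ∑ a, -(dirDeriv a (dirDeriv a w) (x₀ + R • y) * Ψ y) := by
    intro y
    simp [negLaplacian_eq_of_contDiff hw, Finset.sum_mul]
  have e3 : ∀ a, ∫ y, -(dirDeriv a w (x₀ + R • y) * dirDeriv a Ψ y) =
      -(R * ∫ y, -(dirDeriv a (dirDeriv a w) (x₀ + R • y) * Ψ y)) := by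
    intro a
    have h := integral_dirDeriv_mul isOpen_univ ((hd a).of_le (by norm_cast)).contDiffOn
      hρ.contDiff_potential hρ.hasCompactSupport_potential (subset_univ _) a
    simp only [dirDeriv_comp_add_smul, mul_assoc, integral_const_mul] at h
    rw [integral_neg, integral_neg, ← h]
    ring
  simp only [e1, e2]
  rw [integral_finsetSum, integral_finsetSum, Finset.mul_sum, ← Finset.sum_neg_distrib]
  · exact Finset.sum_congr rfl fun a _ => e3 a
  · exact fun a _ => (((hdd a).continuous.mul
      hρ.contDiff_potential.continuous).integrable_of_hasCompactSupport
      hρ.hasCompactSupport_potential.mul_left).neg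
  · exact fun a _ => (((hd a).continuous.mul
      (hρ.contDiff_potential.dirDeriv a).continuous).integrable_of_hasCompactSupport
      (HasCompactSupport.mul_left (hρ.hasCompactSupport_potential.of_isClosed_subset
        (isClosed_tsupport _) (tsupport_dirDeriv_subset Ψ a)))).neg

/-- The mean value inequality for smooth superharmonic functions. -/
theorem IsRadialKernel.integral_le_of_negLaplacian_nonneg (hρ : IsRadialKernel ρ Ψ)
    {w : EuclideanSpace ℝ (Fin N) → ℝ} (hw : ContDiff ℝ ∞ w) (h0 : ∀ x, 0 ≤ negLaplacian w x)
    (x₀ : EuclideanSpace ℝ (Fin N)) {R : ℝ} (hR : 0 ≤ R) :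
    ∫ y, w (x₀ + R • y) * ρ y ≤ w x₀ := by
  have hd := hasDerivAt_integral_dilation hw hρ.contDiff.continuous hρ.hasCompactSupport x₀
  have h : AntitoneOn (fun R : ℝ => ∫ y, w (x₀ + R • y) * ρ y) (Ici 0) := by
    refine antitoneOn_of_deriv_nonpos (convex_Ici 0)
      (fun r _ => (hd r).continuousAt.continuousWithinAt)
      (fun r _ => (hd r).differentiableAt.differentiableWithinAt) fun r hr => ?_
    rw [interior_Ici] at hr
    rw [(hd r).deriv, hρ.integral_fderiv_mul hw]
    exact neg_nonpos.2 (mul_nonneg hr.le (integral_nonneg fun y =>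
      mul_nonneg (h0 _) (hρ.potential_nonneg y)))
  -- At scale `0` the average is `w x₀`, because `ρ` has mass one.
  have h2 := h (mem_Ici.2 le_rfl) (mem_Ici.2 hR) hR
  simpa [integral_const_mul, hρ.integral_eq_one] using h2

/-- Averages of the Laplacian of a bounded function over large scales are small. -/
theorem IsRadialKernel.nonpos_of_le_abs_integral_negLaplacian (hρ : IsRadialKernel ρ Ψ)
    {u : EuclideanSpace ℝ (Fin N) → ℝ} (hu : ContDiff ℝ ∞ u) {M : ℝ} (hM : ∀ x, |u x| ≤ M)
    (x₀ : EuclideanSpace ℝ (Fin N)) {δ : ℝ}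
    (hδ : ∀ R : ℝ, 0 < R → δ ≤ |∫ y, negLaplacian u (x₀ + R • y) * ρ y|) : δ ≤ 0 := by
  have hM0 : 0 ≤ M := (abs_nonneg _).trans (hM 0)
  set K := ∫ y, |negLaplacian ρ y| with hK
  have hK0 : 0 ≤ K := integral_nonneg fun y => abs_nonneg _
  have hint : Integrable fun y => |negLaplacian ρ y| :=
    (hρ.contDiff.negLaplacian.continuous.integrable_of_hasCompactSupport
      (hρ.hasCompactSupport.iterate_negLaplacian 1)).abs
  -- Moving the Laplacian onto `ρ` gains `R ^ 2`, while the other side is bounded independently of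
  -- `R`.
  have key : ∀ R : ℝ, 0 < R → R ^ 2 * δ ≤ M * K := by
    intro R hR
    have hc : ContDiff ℝ ∞ fun y => u (x₀ + R • y) := hu.comp (by fun_prop)
    have h := integral_negLaplacian_mul isOpen_univ (hc.of_le (by norm_cast)).contDiffOn
      hρ.contDiff hρ.hasCompactSupport (subset_univ _)
    simp only [negLaplacian_comp_add_smul hu, mul_assoc, integral_const_mul] at h
    calc R ^ 2 * δ ≤ R ^ 2 * |∫ y, negLaplacian u (x₀ + R • y) * ρ y| :=
          mul_le_mul_of_nonneg_left (hδ R hR) (sq_nonneg R)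
      _ = |∫ y, u (x₀ + R • y) * negLaplacian ρ y| := by rw [← h, abs_mul, abs_sq]
      _ ≤ ∫ y, M * |negLaplacian ρ y| := by
          rw [← Real.norm_eq_abs]
          refine norm_integral_le_of_norm_le (hint.const_mul M) (.of_forall fun y => ?_)
          rw [Real.norm_eq_abs, abs_mul]
          exact mul_le_mul_of_nonneg_right (hM _) (abs_nonneg _)
      _ = M * K := by rw [integral_const_mul]
  by_contra! hpos
  have h := key ((M * K + 1) / δ + 1) (by positivity)
  have hq : 0 ≤ (M * K + 1) / δ := by positivity
  have h3 : ((M * K + 1) / δ) * δ = M * K + 1 := div_mul_cancel₀ _ hpos.ne'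
  nlinarith [mul_nonneg (mul_nonneg hq hq) hpos.le]

end Dilation

/-! ### Jensen's inequality -/

section Jensen

variable {N : ℕ}

/-- For any `b` below `g` of the mean, some affine minorant of `g` takes the value `b` at the mean.
Integrating it against `ρ` returns `b`. -/
theorem ConvexOn.map_integral_mul_le {g : ℝ → ℝ} (hg : ConvexOn ℝ univ g)
    {f ρ : EuclideanSpace ℝ (Fin N) → ℝ} (hf : Continuous f) (hρ : Continuous ρ)
    (hc : HasCompactSupport ρ) (h0 : ∀ y, 0 ≤ ρ y) (h1 : ∫ y, ρ y = 1) :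
    g (∫ y, f y * ρ y) ≤ ∫ y, g (f y) * ρ y := by
  have hgc : Continuous g := continuousOn_univ.1 (hg.continuousOn isOpen_univ)
  have hfi : Integrable fun y => f y * ρ y :=
    (hf.mul hρ).integrable_of_hasCompactSupport hc.mul_left
  have hgi : Integrable fun y => g (f y) * ρ y :=
    ((hgc.comp hf).mul hρ).integrable_of_hasCompactSupport hc.mul_left
  have hρi : Integrable ρ := hρ.integrable_of_hasCompactSupport hc
  refine le_of_forall_lt fun a ha => ?_
  obtain ⟨b, hab, hb⟩ := exists_between ha
  obtain ⟨c, d, hcd, hb'⟩ := hg.exists_affine_le_of_lt_real (mem_univ _) hb isClosed_univ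
    hgc.continuousOn.lowerSemicontinuousOn
  refine hab.trans_le ?_
  calc b = ∫ y, (c * (f y * ρ y) + d * ρ y) := by
        rw [integral_add (hfi.const_mul c) (hρi.const_mul d), integral_const_mul,
          integral_const_mul, h1, mul_one, hb']
    _ ≤ ∫ y, g (f y) * ρ y := by
        refine integral_mono ((hfi.const_mul c).add (hρi.const_mul d)) hgi fun y => ?_
        have h := mul_le_mul_of_nonneg_right (hcd (f y) (mem_univ _)) (h0 y)
        simp only
        linarith

end Jensen

/-! ### Mollification of the differential inequality -/

section Mollification

variable {N : ℕ}

/-- The convolution of `v` with the kernel `ζ`. -/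
noncomputable def mollify (v ζ : EuclideanSpace ℝ (Fin N) → ℝ) :
    EuclideanSpace ℝ (Fin N) → ℝ :=
  fun x => ∫ t, v t * ζ (x - t)

variable {v ζ : EuclideanSpace ℝ (Fin N) → ℝ}

theorem mollify_eq_convolution (v ζ : EuclideanSpace ℝ (Fin N) → ℝ) :
    mollify v ζ = convolution v ζ (ContinuousLinearMap.lsmul ℝ ℝ) volume := rfl

theorem contDiff_mollify (hv : Continuous v) (hζ : ContDiff ℝ ∞ ζ) (hc : HasCompactSupport ζ) :
    ContDiff ℝ ∞ (mollify v ζ) :=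
  hc.contDiff_convolution_right (ContinuousLinearMap.lsmul ℝ ℝ) hv.locallyIntegrable hζ

theorem dirDeriv_mollify (hv : Continuous v) (hζ : ContDiff ℝ ∞ ζ) (hc : HasCompactSupport ζ)
    (a : Fin N) : dirDeriv a (mollify v ζ) = mollify v (dirDeriv a ζ) := by
  ext x
  have hζ1 : ContDiff ℝ 1 ζ := hζ.of_le (by norm_cast)
  have h := hc.hasFDerivAt_convolution_right (ContinuousLinearMap.lsmul ℝ ℝ)
    (hv.locallyIntegrable (μ := volume)) hζ1 x
  rw [dirDeriv, mollify_eq_convolution, h.fderiv,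
    convolution_precompR_apply _ hv.locallyIntegrable (hc.fderiv (𝕜 := ℝ))
      (hζ1.continuous_fderiv (by simp))]
  rfl

theorem integrable_mul_comp_sub (hv : Continuous v) (hζ : Continuous ζ)
    (hc : HasCompactSupport ζ) (x : EuclideanSpace ℝ (Fin N)) :
    Integrable fun t => v t * ζ (x - t) :=
  (by fun_prop : Continuous fun t => v t * ζ (x - t)).integrable_of_hasCompactSupport
    (hc.comp_sub_left x).mul_left

/-- All derivatives fall on `ζ`, so `mollify v (negLaplacian^[k] ζ)` plays the role of `(-Δ)^k` of
the mollified function, and bounds on it need only a bound on `v`. -/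
theorem negLaplacian_mollify (hv : Continuous v) (hζ : ContDiff ℝ ∞ ζ)
    (hc : HasCompactSupport ζ) : negLaplacian (mollify v ζ) = mollify v (negLaplacian ζ) := by
  have hcs : ∀ {ξ : EuclideanSpace ℝ (Fin N) → ℝ} (a : Fin N), HasCompactSupport ξ →
      HasCompactSupport (dirDeriv a ξ) := fun {ξ} a h =>
    h.of_isClosed_subset (isClosed_tsupport _) (tsupport_dirDeriv_subset ξ a)
  rw [negLaplacian_eq_of_contDiff (contDiff_mollify hv hζ hc), negLaplacian_eq_of_contDiff hζ]
  ext x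
  simp only [dirDeriv_mollify hv hζ hc, dirDeriv_mollify hv (hζ.dirDeriv _) (hcs _ hc),
    Pi.neg_apply, Finset.sum_apply]
  simp only [mollify, Pi.neg_apply, Finset.sum_apply, mul_neg, integral_neg, Finset.mul_sum]
  rw [integral_finsetSum]
  exact fun a _ => integrable_mul_comp_sub hv ((hζ.dirDeriv a).dirDeriv a).continuous
    (hcs a (hcs a hc)) x

theorem abs_mollify_le (hζ : Continuous ζ) (hc : HasCompactSupport ζ) {M : ℝ}
    (hM : ∀ x, |v x| ≤ M) (x : EuclideanSpace ℝ (Fin N)) :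
    |mollify v ζ x| ≤ M * ∫ t, |ζ t| := by
  have hi : Integrable fun t => |ζ (x - t)| :=
    ((by fun_prop : Continuous fun t => ζ (x - t)).integrable_of_hasCompactSupport
      (hc.comp_sub_left x)).abs
  calc |mollify v ζ x| ≤ ∫ t, M * |ζ (x - t)| := by
        rw [← Real.norm_eq_abs]
        refine norm_integral_le_of_norm_le (hi.const_mul M) (.of_forall fun t => ?_)
        rw [Real.norm_eq_abs, abs_mul]
        exact mul_le_mul_of_nonneg_right (hM t) (abs_nonneg _)
    _ = M * ∫ t, |ζ t| := by
        rw [integral_const_mul, integral_sub_left_eq_self (fun t => |ζ t|)]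

theorem tendsto_mollify {ι : Type*} {l : Filter ι}
    {b : ι → ContDiffBump (0 : EuclideanSpace ℝ (Fin N))}
    (hb : Filter.Tendsto (fun i => (b i).rOut) l (nhds 0)) (hv : Continuous v)
    (x : EuclideanSpace ℝ (Fin N)) :
    Filter.Tendsto (fun i => mollify v ((b i).normed volume) x) l (nhds (v x)) := by
  refine (ContDiffBump.convolution_tendsto_right_of_continuous (μ := volume) hb hv x).congr
    fun i => ?_
  rw [convolution_eq_swap]
  simp [mollify, mul_comm]

theorem mollify_iterate_negLaplacian_eq {m : ℕ} (hv : MemSobolevLoc (2 * m) univ v)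
    (hζ : ContDiff ℝ ∞ ζ) (hc : HasCompactSupport ζ) (x : EuclideanSpace ℝ (Fin N)) :
    mollify v (negLaplacian^[m] ζ) x = ∫ t, weakPolyLaplacian m univ v t * ζ (x - t) := by
  have hζx : ContDiff ℝ ∞ fun t => ζ (x - t) := hζ.comp (by fun_prop)
  rw [hv.integral_weakPolyLaplacian_mul hζx (hc.comp_sub_left x)
    (subset_univ _), iterate_negLaplacian_comp_sub hζ]
  rfl

/-- Mollification preserves the inequality `(-Δ)^m v ≥ g(v)` with convex `g`. -/
theorem ConvexOn.le_mollify_iterate_negLaplacian {m : ℕ} {g : ℝ → ℝ} (hg : ConvexOn ℝ univ g)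
    (hv : Continuous v) (hvs : MemSobolevLoc (2 * m) univ v)
    (hgv : ∀ᵐ x, g (v x) ≤ weakPolyLaplacian m univ v x)
    (hζ : ContDiff ℝ ∞ ζ) (hc : HasCompactSupport ζ) (h0 : ∀ y, 0 ≤ ζ y) (h1 : ∫ y, ζ y = 1)
    (x : EuclideanSpace ℝ (Fin N)) :
    g (mollify v ζ x) ≤ mollify v (negLaplacian^[m] ζ) x := by
  have hgc : Continuous g := continuousOn_univ.1 (hg.continuousOn isOpen_univ)
  have hζx : Continuous fun t => ζ (x - t) := hζ.continuous.comp (by fun_prop)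
  rw [mollify_iterate_negLaplacian_eq hvs hζ hc]
  refine (hg.map_integral_mul_le hv hζx (hc.comp_sub_left x) (fun t => h0 _)
    (by rw [integral_sub_left_eq_self ζ, h1])).trans ?_
  refine integral_mono_ae (integrable_mul_comp_sub (hgc.comp hv) hζ.continuous hc x)
    (hvs.locallyIntegrableOn_weakPolyLaplacian.integrable_mul_of_tsupport_subset hζx
      (hc.comp_sub_left x) (subset_univ _)) ?_
  filter_upwards [hgv] with t ht
  exact mul_le_mul_of_nonneg_right ht (h0 _)

end Mollification

/-! ### Part (a): the whole space -/

section WholeSpace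

variable {N : ℕ}

/-- `-Δu` is superharmonic, so a negative value at `x` dominates all its averages around `x`,
keeping them away from zero; boundedness of `u` makes these averages decay. -/
theorem negLaplacian_nonneg_of_bounded {u : EuclideanSpace ℝ (Fin N) → ℝ} (hu : ContDiff ℝ ∞ u)
    {M : ℝ} (hM : ∀ x, |u x| ≤ M) (h : ∀ x, 0 ≤ negLaplacian (negLaplacian u) x)
    (x : EuclideanSpace ℝ (Fin N)) : 0 ≤ negLaplacian u x := by
  obtain ⟨ρ, Ψ, hρ⟩ := exists_isRadialKernel N
  by_contra! hx
  refine absurd (hρ.nonpos_of_le_abs_integral_negLaplacian hu hM x (δ := -negLaplacian u x)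
    fun R hR => ?_) (by linarith)
  refine le_trans ?_ (neg_le_abs _)
  exact neg_le_neg (hρ.integral_le_of_negLaplacian_nonneg hu.negLaplacian h x hR.le)

/-- Descending induction from `k = m`. It stops at `k = 1`, as the step applies the previous lemma
to the bounded function with one Laplacian fewer, of index `j = k - 1`. -/
theorem mollify_iterate_negLaplacian_nonneg {m : ℕ} {v ζ : EuclideanSpace ℝ (Fin N) → ℝ}
    (hv : Continuous v) {M : ℝ} (hM : ∀ x, |v x| ≤ M) (hζ : ContDiff ℝ ∞ ζ)
    (hc : HasCompactSupport ζ) (h : ∀ x, 0 ≤ mollify v (negLaplacian^[m] ζ) x) {k : ℕ}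
    (hk : 1 ≤ k) (hkm : k ≤ m) (x : EuclideanSpace ℝ (Fin N)) :
    0 ≤ mollify v (negLaplacian^[k] ζ) x := by
  have hs := contDiff_iterate_negLaplacian hζ
  have hcs := hc.iterate_negLaplacian
  have hL : ∀ j, negLaplacian (mollify v (negLaplacian^[j] ζ)) =
      mollify v (negLaplacian^[j + 1] ζ) := fun j => by
    rw [negLaplacian_mollify hv (hs j) (hcs j), Function.iterate_succ_apply']
  induction hkm using Nat.decreasingInduction generalizing x with
  | self => exact h x
  | of_succ k _ ih =>
    obtain ⟨j, rfl⟩ : ∃ j, k = j + 1 := ⟨k - 1, by omega⟩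
    rw [← hL j]
    refine negLaplacian_nonneg_of_bounded (contDiff_mollify hv (hs j) (hcs j))
      (abs_mollify_le (hs j).continuous (hcs j) hM) (fun y => ?_) x
    rw [hL, hL]
    exact ih (by omega) y

theorem mollify_nonneg {m : ℕ} (hm : 1 ≤ m) {g : ℝ → ℝ} {v ζ : EuclideanSpace ℝ (Fin N) → ℝ}
    (hg : ConvexOn ℝ univ g) (hg0 : ∀ s, 0 ≤ g s) (hgpos : ∀ s < 0, 0 < g s)
    (hv : Continuous v) {M : ℝ} (hM : ∀ x, |v x| ≤ M)
    (hζ : ContDiff ℝ ∞ ζ) (hc : HasCompactSupport ζ)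
    (h : ∀ x, g (mollify v ζ x) ≤ mollify v (negLaplacian^[m] ζ) x)
    (x : EuclideanSpace ℝ (Fin N)) : 0 ≤ mollify v ζ x := by
  obtain ⟨ρ, Ψ, hρ⟩ := exists_isRadialKernel N
  obtain ⟨n, rfl⟩ : ∃ n, m = n + 1 := ⟨m - 1, by omega⟩
  have hgc : Continuous g := continuousOn_univ.1 (hg.continuousOn isOpen_univ)
  set w := mollify v ζ with hw_def
  have hw : ContDiff ℝ ∞ w := contDiff_mollify hv hζ hc
  set K := M * ∫ t, |ζ t| with hK
  have hwK : ∀ y, |w y| ≤ K := abs_mollify_le hζ.continuous hc hM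
  have h1 : ∀ y, 0 ≤ negLaplacian w y := fun y => by
    rw [hw_def, negLaplacian_mollify hv hζ hc]
    exact mollify_iterate_negLaplacian_nonneg hv hM hζ hc (fun z => (hg0 _).trans (h z)) le_rfl hm y
  have hρi := hρ.contDiff.continuous.integrable_of_hasCompactSupport (μ := volume)
    hρ.hasCompactSupport
  by_contra! hx
  have hKx : -K ≤ w x := (abs_le.1 (hwK x)).1
  -- The minimum of `g` over the compact interval provides one positive `δ = g s` valid at all
  -- scales, since `s ≤ w x < 0`.
  obtain ⟨s, hsI, hmin⟩ := (isCompact_Icc (a := -K) (b := w x)).exists_isMinOn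
    (nonempty_Icc.2 hKx) hgc.continuousOn
  have hs := contDiff_iterate_negLaplacian hζ n
  have hcs := hc.iterate_negLaplacian n
  refine absurd (hρ.nonpos_of_le_abs_integral_negLaplacian (contDiff_mollify hv hs hcs)
    (abs_mollify_le hs.continuous hcs hM) x (δ := g s) fun R hR => ?_)
    (not_le.2 (hgpos s (by linarith [hsI.2])))
  have hwR : Continuous fun y => w (x + R • y) := hw.continuous.comp (by fun_prop)
  have hmem : ∫ y, w (x + R • y) * ρ y ∈ Icc (-K) (w x) := by
    refine ⟨?_, hρ.integral_le_of_negLaplacian_nonneg hw h1 x hR.le⟩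
    calc -K = ∫ y, -K * ρ y := by rw [integral_const_mul, hρ.integral_eq_one, mul_one]
      _ ≤ _ := integral_mono (hρi.const_mul _)
          ((hwR.mul hρ.contDiff.continuous).integrable_of_hasCompactSupport
            hρ.hasCompactSupport.mul_left)
          fun y => mul_le_mul_of_nonneg_right (abs_le.1 (hwK _)).1 (hρ.nonneg y)
  rw [negLaplacian_mollify hv hs hcs, ← Function.iterate_succ_apply' negLaplacian]
  have hz : Continuous fun y => mollify v (negLaplacian^[n + 1] ζ) (x + R • y) :=
    (contDiff_mollify hv (contDiff_iterate_negLaplacian hζ (n + 1))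
      (hc.iterate_negLaplacian (n + 1))).continuous.comp (by fun_prop)
  calc g s ≤ g (∫ y, w (x + R • y) * ρ y) := hmin hmem
    _ ≤ ∫ y, g (w (x + R • y)) * ρ y := hg.map_integral_mul_le hwR hρ.contDiff.continuous
        hρ.hasCompactSupport hρ.nonneg hρ.integral_eq_one
    _ ≤ ∫ y, mollify v (negLaplacian^[n + 1] ζ) (x + R • y) * ρ y :=
        integral_mono (((hgc.comp hwR).mul
          hρ.contDiff.continuous).integrable_of_hasCompactSupport hρ.hasCompactSupport.mul_left)
          ((hz.mul hρ.contDiff.continuous).integrable_of_hasCompactSupport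
            hρ.hasCompactSupport.mul_left)
          fun y => mul_le_mul_of_nonneg_right (h _) (hρ.nonneg y)
    _ ≤ _ := le_abs_self _

/-- The strong minimum principle, from the mean value inequality on all scales. -/
theorem IsRadialKernel.pos_or_eq_zero {ρ Ψ v : EuclideanSpace ℝ (Fin N) → ℝ}
    (hρ : IsRadialKernel ρ Ψ) (hv : Continuous v) (h0 : ∀ x, 0 ≤ v x)
    (hmean : ∀ x, ∀ R : ℝ, 0 < R → ∫ y, v (x + R • y) * ρ y ≤ v x) :
    (∀ x, 0 < v x) ∨ ∀ x, v x = 0 := by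
  by_contra! hcon
  obtain ⟨⟨x, hx⟩, z, hz⟩ := hcon
  have hx0 : v x = 0 := le_antisymm hx (h0 x)
  -- At this scale `z` lies in the open ball around `x` on which the dilated kernel is positive.
  set R : ℝ := ‖z - x‖ + 1 with hR
  have hR0 : 0 < R := by positivity
  have hρc := hρ.contDiff.continuous
  have hc : Continuous fun y => v (x + R • y) * ρ y := by fun_prop
  have hi := hc.integrable_of_hasCompactSupport (μ := volume)
    (hρ.hasCompactSupport.mul_left (f := fun y => v (x + R • y)))
  have hnn : ∀ y, 0 ≤ v (x + R • y) * ρ y := fun y => mul_nonneg (h0 _) (hρ.nonneg y)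
  have hint : ∫ y, v (x + R • y) * ρ y = 0 :=
    le_antisymm ((hmean x R hR0).trans hx) (integral_nonneg hnn)
  have hz0 := congrFun ((hc.ae_eq_iff_eq volume continuous_const).1
    ((integral_eq_zero_iff_of_nonneg hnn hi).1 hint)) (R⁻¹ • (z - x))
  have hpos : 0 < ρ (R⁻¹ • (z - x)) := by
    refine hρ.pos _ ?_
    rw [norm_smul, Real.norm_of_nonneg (inv_nonneg.2 hR0.le), inv_mul_lt_iff₀ hR0]
    linarith
  rw [smul_inv_smul₀ hR0.ne', add_sub_cancel] at hz0
  exact hz ((mul_eq_zero.1 hz0).resolve_right hpos.ne')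

theorem MemSobolevLoc.pos_or_eq_zero {m : ℕ} (hm : 1 ≤ m) {g : ℝ → ℝ}
    {v : EuclideanSpace ℝ (Fin N) → ℝ} (hvs : MemSobolevLoc (2 * m) univ v)
    (hg : ConvexOn ℝ univ g) (hg0 : ∀ s, 0 ≤ g s) (hgpos : ∀ s < 0, 0 < g s)
    (hv : Continuous v) {M : ℝ} (hM : ∀ x, |v x| ≤ M)
    (hgv : ∀ᵐ x, g (v x) ≤ weakPolyLaplacian m univ v x) :
    (∀ x, 0 < v x) ∨ ∀ x, v x = 0 := by
  obtain ⟨ρ, Ψ, hρ⟩ := exists_isRadialKernel N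
  let b : ℕ → ContDiffBump (0 : EuclideanSpace ℝ (Fin N)) := fun n =>
    ⟨1 / ((n : ℝ) + 1) / 2, 1 / ((n : ℝ) + 1), by positivity, half_lt_self (by positivity)⟩
  have hb : Filter.Tendsto (fun n => (b n).rOut) Filter.atTop (nhds 0) :=
    tendsto_one_div_add_atTop_nhds_zero_nat
  set w := fun n => mollify v ((b n).normed volume) with hw_def
  have hs : ∀ n, ContDiff ℝ ∞ ((b n).normed volume) := fun n => (b n).contDiff_normed
  have hc : ∀ n, HasCompactSupport ((b n).normed volume) := fun n => (b n).hasCompactSupport_normed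
  have hlim : ∀ x, Filter.Tendsto (fun n => w n x) Filter.atTop (nhds (v x)) :=
    tendsto_mollify hb hv
  have hwM : ∀ n x, |w n x| ≤ M := fun n x => by
    have h := abs_mollify_le (hs n).continuous (hc n) hM x
    simpa [abs_of_nonneg ((b n).nonneg_normed _), (b n).integral_normed] using h
  have hineq : ∀ n x, g (w n x) ≤ mollify v (negLaplacian^[m] ((b n).normed volume)) x :=
    fun n x => hg.le_mollify_iterate_negLaplacian hv hvs hgv (hs n) (hc n)
      (b n).nonneg_normed (b n).integral_normed x
  have hws : ∀ n, ContDiff ℝ ∞ (w n) := fun n => contDiff_mollify hv (hs n) (hc n)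
  have hsup : ∀ n x, 0 ≤ negLaplacian (w n) x := fun n x => by
    rw [hw_def, negLaplacian_mollify hv (hs n) (hc n)]
    exact mollify_iterate_negLaplacian_nonneg hv hM (hs n) (hc n)
      (fun z => (hg0 _).trans (hineq n z)) le_rfl hm x
  have hv0 : ∀ x, 0 ≤ v x := fun x => ge_of_tendsto' (hlim x) fun n =>
    mollify_nonneg hm hg hg0 hgpos hv hM (hs n) (hc n) (hineq n) x
  -- `v` may lack classical second derivatives, so its mean value inequality is obtained as the
  -- limit of those of the mollifications, dominated by `M * ρ y`.
  refine hρ.pos_or_eq_zero hv hv0 fun x R hR => ?_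
  refine le_of_tendsto_of_tendsto' (?_ : Filter.Tendsto (fun n => ∫ y, w n (x + R • y) * ρ y)
    Filter.atTop _) (hlim x) fun n =>
      hρ.integral_le_of_negLaplacian_nonneg (hws n) (hsup n) x hR.le
  have hρc := hρ.contDiff.continuous
  refine tendsto_integral_of_dominated_convergence (fun y => M * ρ y) (fun n => ?_)
    ((hρc.integrable_of_hasCompactSupport hρ.hasCompactSupport).const_mul M) (fun n => ?_)
    (.of_forall fun y => (hlim _).mul_const _)
  · have := (hws n).continuous
    exact (by fun_prop : Continuous fun y => w n (x + R • y) * ρ y).aestronglyMeasurable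
  · refine .of_forall fun y => ?_
    rw [Real.norm_eq_abs, abs_mul, abs_of_nonneg (hρ.nonneg y)]
    exact mul_le_mul_of_nonneg_right (hwM _ _) (hρ.nonneg y)

end WholeSpace

theorem mainTheorem4 (N m : ℕ) [NeZero N] (hm : 1 ≤ m) :
    (∀ (g : ℝ → ℝ) (v : EuclideanSpace ℝ (Fin N) → ℝ),
      ConvexOn ℝ univ g → (∀ s, 0 ≤ g s) → (∀ s < 0, 0 < g s) →
      MemSobolevLoc (2 * m) univ v →
      ContDiff ℝ ((2 * m - 1 : ℕ) : ℕ∞) v →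
      (∀ k ≤ 2 * m - 1, ∀ i : Fin k → Fin N, ∃ C : ℝ, ∀ x, |partialDeriv i v x| ≤ C) →
      (∀ᵐ x, g (v x) ≤ weakPolyLaplacian m univ v x) →
      (∀ x, 0 < v x) ∨ (∀ x, v x = 0)) ∧
    (∀ v : EuclideanSpace ℝ (Fin N) → ℝ,
      MemSobolevLoc (2 * m) (halfSpace N) v →
      ContDiffOn ℝ ((2 * m - 1 : ℕ) : ℕ∞) v (halfSpace N) →
      (∀ᵐ x ∂(volume.restrict (halfSpace N)), 1 ≤ weakPolyLaplacian m (halfSpace N) v x) →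
      ¬ ∃ C : ℝ, ∀ x ∈ halfSpace N, |negLaplacian^[m - 1] v x| ≤ C) := by
  refine ⟨fun g v hg hg0 hgpos hvs hv hbd hgv => ?_,
    fun v hvs hv h1 => hvs.not_exists_bound_halfSpace hm hv h1⟩
  -- The derivative along the empty sequence of directions is `v` itself.
  obtain ⟨M, hM⟩ := hbd 0 (Nat.zero_le _) Fin.elim0
  exact hvs.pos_or_eq_zero hm hg hg0 hgpos hv.continuous (fun x => by simpa [partialDeriv] using hM x)
    hgv
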